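/- Let $n, k, d_{in}, d_{out}$ be natural numbers with $k\ge 1$. The symmetric group $S_n$ acts on $\mathbb R^{n\times d}$ by $(\sigma\cdot X)_{i,:}=X_{\sigma^{-1}(i),:}$ and on $\mathbb R^{n^k\times d}$ by $(\sigma\cdot Y)_{(i_1,\dots,i_k),:}=Y_{(\sigma^{-1}(i_1),\dots,\sigma^{-1}(i_k)),:}$; a map $F$ between such spaces is equivariant if $F(\sigma\cdot X)=\sigma\cdot F(X)$ for all $\sigma\in S_n$ and all $X$. Let $\Phi$ be a set-to-set model, i.e. a family $\Phi_{d_1}$ of maps $\mathbb R^{n\times d_{in}}\to\mathbb R^{n\times d_1}$ for each $d_1$, which is equivariant universal: all its members are equivariant, and for every $d_1$, every continuous equivariant $H:\mathbb R^{n\times d_{in}}\to\mathbb R^{n\times d_1}$, every compact $K\subset\mathbb R^{n\times d_{in}}$ and every $\epsilon>0$ there is $\varphi\in\Phi_{d_1}$ with $|H(X)_{i,j}-\varphi(X)_{i,j}|<\epsilon$ for all $X\in K$ and all $i,j$. Consider the model consisting of all maps $F^k=\psi\circ\beta\circ\varphi:\mathbb R^{n\times d_{in}}\to\mathbb R^{n^k\times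 d_{out}}$, where $\varphi\in\Phi_{d_1}$ for some $d_1$, where $\beta:\mathbb R^{n\times d_1}\to\mathbb R^{n^k\times kd_1}$ is the broadcasting layer $\beta(X)_{(i_1,\dots,i_k),:}=[x_{i_1},\dots,x_{i_k}]$ (concatenation of rows of $X$), and where $\psi(Y)_{i,:}=m(Y_{i,:})$ for all $i\in[n]^k$, with one multi-layer perceptron $m:\mathbb R^{kd_1}\to\mathbb R^{d_{out}}$ (affine layers, with the ReLU applied entrywise between layers; arbitrary depth and widths). Then this model is set-to-$k$-edge universal: all its members are equivariant, and for every continuous equivariant $G:\mathbb R^{n\times d_{in}}\to\mathbb R^{n^k\times d_{out}}$, every compact $K\subset\mathbb R^{n\times d_{in}}$ and every $\epsilon>0$, there is a map $F^k$ in the model such that $|G(X)_{i,j}-F^k(X)_{i,j}|<\epsilon$ for all $X\in K$, all $k$-edges $i$ (multi-indices $i=(i_1,\dots,i_k)\in[n]^k$ with pairwise distinct entries) and all $1\le j\le d_{out}$. In particular, the conclusion holds unconditionally when $\varphi$ ranges over the DeepSets networks, i.e. compositions of layers $X\mapsto XA+\mathbf 1\mathbf 1^TXB+\mathbf 1c^T$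 of arbitrary number and widths, with the ReLU applied entrywise between layers. -/

import Mathlib

namespace SetToGraph

/-- A set of `n` feature vectors in `ℝ^d`, as an `n × d` matrix whose rows are the vectors. -/
abbrev SetData (n d : ℕ) : Type := Fin n → Fin d → ℝ

/-- A tensor in `ℝ^{n^k × d}`: a feature vector in `ℝ^d` for each multi-index in `[n]^k`. -/
abbrev EdgeData (n k d : ℕ) : Type := (Fin k → Fin n) → Fin d → ℝ

/-- The action of a permutation on sets: `(σ · X)_{i,:} = X_{σ⁻¹(i),:}`. -/
def permSet {n d : ℕ} (σ : Equiv.Perm (Fin n)) (X : SetData n d) : SetData n d :=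
  fun i => X (σ⁻¹ i)

/-- The action of a permutation on tensors: `(σ · Y)_{i,:} = Y_{σ⁻¹(i),:}`, where
`σ⁻¹(i) = (σ⁻¹(i₁), …, σ⁻¹(i_k))`. -/
def permEdge {n k d : ℕ} (σ : Equiv.Perm (Fin n)) (Y : EdgeData n k d) : EdgeData n k d :=
  fun i => Y (fun t => σ⁻¹ (i t))

/-- Permutation equivariance of a set-to-set function. -/
def SetEquivariant {n a b : ℕ} (f : SetData n a → SetData n b) : Prop :=
  ∀ (σ : Equiv.Perm (Fin n)) (X : SetData n a), f (permSet σ X) = permSet σ (f X)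

/-- Permutation equivariance of a set-to-`k`-edge function. -/
def EdgeEquivariant {n k a b : ℕ} (F : SetData n a → EdgeData n k b) : Prop :=
  ∀ (σ : Equiv.Perm (Fin n)) (X : SetData n a), F (permSet σ X) = permEdge σ (F X)

/-- The rectified linear unit. -/
def relu (x : ℝ) : ℝ := max x 0

/-- The functions `ℝ^a → ℝ^b` computed by a multi-layer perceptron of arbitrary depth and
arbitrary widths: affine layers, with the ReLU applied entrywise between the layers. -/
inductive IsMLP {a : ℕ} : {b : ℕ} → ((Fin a → ℝ) → (Fin b → ℝ)) → Prop
  | affine {b : ℕ} (W : Matrix (Fin b) (Fin a) ℝ) (c : Fin b → ℝ) :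
      IsMLP (fun x => W.mulVec x + c)
  | layer {b b' : ℕ} {f : (Fin a → ℝ) → (Fin b → ℝ)} (hf : IsMLP f)
      (W : Matrix (Fin b') (Fin b) ℝ) (c : Fin b' → ℝ) :
      IsMLP (fun x => W.mulVec (fun t => relu (f x t)) + c)

/-- The affine DeepSets layer `X ↦ X A + 1 1ᵀ X B + 1 cᵀ`: row `i` of the output is
`x_i A + (∑_j x_j) B + c`. -/
def deepSetsLayer (n : ℕ) {a b : ℕ} (A B : Matrix (Fin a) (Fin b) ℝ) (c : Fin b → ℝ)
    (X : SetData n a) : SetData n b :=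
  fun i => Matrix.vecMul (X i) A + Matrix.vecMul (∑ j, X j) B + c

/-- The set-to-set functions `ℝ^{n × a} → ℝ^{n × b}` computed by a DeepSets network of arbitrary
depth and arbitrary widths, with the ReLU applied entrywise between the layers. -/
inductive IsDeepSets {n a : ℕ} : {b : ℕ} → (SetData n a → SetData n b) → Prop
  | affine {b : ℕ} (A B : Matrix (Fin a) (Fin b) ℝ) (c : Fin b → ℝ) :
      IsDeepSets (deepSetsLayer n A B c)
  | layer {b b' : ℕ} {f : SetData n a → SetData n b} (hf : IsDeepSets f)
      (A B : Matrix (Fin b) (Fin b') ℝ) (c : Fin b' → ℝ) :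
      IsDeepSets (fun X => deepSetsLayer n A B c (fun i t => relu (f X i t)))

/-- A set-to-set model: for each output dimension `d₁`, the functions
`ℝ^{n × din} → ℝ^{n × d₁}` that the model can realize. -/
abbrev SetModel (n din : ℕ) : Type := (d₁ : ℕ) → Set (SetData n din → SetData n d₁)

/-- The DeepSets set-to-set model. -/
def deepSets (n din : ℕ) : SetModel n din := fun _ => {f | IsDeepSets f}

/-- A set-to-set model is equivariant universal if all its functions are equivariant and, for each
output dimension, they approximate every continuous equivariant set-to-set function uniformly on
every compact set. -/
def SetModel.IsUniversal {n din : ℕ} (Φ : SetModel n din) : Prop :=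
  (∀ d₁ : ℕ, ∀ φ ∈ Φ d₁, SetEquivariant φ) ∧
  ∀ (d₁ : ℕ) (H : SetData n din → SetData n d₁), Continuous H → SetEquivariant H →
    ∀ K : Set (SetData n din), IsCompact K → ∀ ε : ℝ, 0 < ε →
      ∃ φ ∈ Φ d₁, ∀ X ∈ K, ∀ (i : Fin n) (j : Fin d₁), |H X i j - φ X i j| < ε

/-- The broadcasting layer `β(X)_{i,:} = [x_{i₁}, x_{i₂}, …, x_{i_k}]` (concatenation of the rows);
`finProdFinEquiv` sends `(t, j)` to position `t * d₁ + j`. -/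
def broadcast {n d₁ : ℕ} (k : ℕ) (X : SetData n d₁) : EdgeData n k (k * d₁) :=
  fun i s => X (i (finProdFinEquiv.symm s).1) (finProdFinEquiv.symm s).2

/-- The map `ψ` that applies `m` independently to each feature vector of a tensor. -/
def edgewise {n k d₂ dout : ℕ} (m : (Fin d₂ → ℝ) → (Fin dout → ℝ)) (Y : EdgeData n k d₂) :
    EdgeData n k dout :=
  fun i => m (Y i)

/-- The set-to-`k`-edge model: all functions `F^k = ψ ∘ β ∘ φ`, where `φ` belongs to the given
set-to-set model (with any feature dimension `d₁`) and `ψ` applies one MLP to each `k`-edge. -/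
def edgeModel {n din : ℕ} (Φ : SetModel n din) (k dout : ℕ) :
    Set (SetData n din → EdgeData n k dout) :=
  {F | ∃ (d₁ : ℕ) (φ : SetData n din → SetData n d₁) (m : (Fin (k * d₁) → ℝ) → (Fin dout → ℝ)),
    φ ∈ Φ d₁ ∧ IsMLP m ∧ F = fun X => edgewise m (broadcast k (φ X))}

/-- A family of set-to-`k`-edge functions is set-to-`k`-edge universal if all its members are
equivariant and they approximate every continuous equivariant set-to-`k`-edge function uniformly on
every compact set. The `k`-edges are the multi-indices without repetition. -/
def IsEdgeUniversal {n din k dout : ℕ} (M : Set (SetData n din → EdgeData n k dout)) : Prop :=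
  (∀ F ∈ M, EdgeEquivariant F) ∧
  ∀ G : SetData n din → EdgeData n k dout, Continuous G → EdgeEquivariant G →
    ∀ K : Set (SetData n din), IsCompact K → ∀ ε : ℝ, 0 < ε →
      ∃ F ∈ M, ∀ X ∈ K, ∀ i : Fin k → Fin n, Function.Injective i →
        ∀ j : Fin dout, |G X i j - F X i j| < ε

end SetToGraph

/-! Take DeepSets first. Two networks can run side by side whatever their depths, because `x = relu
x - relu (-x)` carries a value unchanged through a ReLU layer. Hence the scalar functions of (set,
edge) in the DeepSets edge model are closed under affine combinations, maxima and minima, and a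
lattice Stone–Weierstrass argument applies on `K` times the finite set of `k`-edges.

It remains to separate points (`exists_deepSetsScalar_ne`). If no model function distinguishes `(X,
i)` from `(Y, j)`, then the rows along the two edges agree, and counting rows by pooled bumps shows
that `X` and `Y` have the same multiset of rows. As the edges have distinct entries, one permutation
carries `X` to `Y` and `i` to `j` (`exists_perm_of_card_eq`), so an equivariant `G` cannot
distinguish them either.

For a universal `Φ`, approximate the inner DeepSets map by a member of `Φ`; continuity of the MLP
near a compact set controls the error. -/

namespace SetToGraph

/-! ### Concatenation and ReLU on vectors -/

/-- The linear map `v ↦ [P v, Q v]`. -/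
def appendLinear {V : Type*} [AddCommGroup V] [Module ℝ V] {a b : ℕ}
    (P : V →ₗ[ℝ] (Fin a → ℝ)) (Q : V →ₗ[ℝ] (Fin b → ℝ)) : V →ₗ[ℝ] (Fin (a + b) → ℝ) where
  toFun v := Fin.append (P v) (Q v)
  map_add' u v := by ext t; refine Fin.addCases ?_ ?_ t <;> simp
  map_smul' r v := by ext t; refine Fin.addCases ?_ ?_ t <;> simp

/-- The projection of `ℝ^{a+b}` to its first `a` coordinates. -/
def fstLinear (a b : ℕ) : (Fin (a + b) → ℝ) →ₗ[ℝ] (Fin a → ℝ) :=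
  LinearMap.funLeft ℝ ℝ (Fin.castAdd b)

/-- The projection of `ℝ^{a+b}` to its last `b` coordinates. -/
def sndLinear (a b : ℕ) : (Fin (a + b) → ℝ) →ₗ[ℝ] (Fin b → ℝ) :=
  LinearMap.funLeft ℝ ℝ (Fin.natAdd a)

/-- The entrywise ReLU. -/
def reluVec {a : ℕ} (x : Fin a → ℝ) : Fin a → ℝ := fun t => relu (x t)

section

variable {a b : ℕ}

@[simp] theorem appendLinear_apply {V : Type*} [AddCommGroup V] [Module ℝ V]
    (P : V →ₗ[ℝ] (Fin a → ℝ)) (Q : V →ₗ[ℝ] (Fin b → ℝ)) (v : V) :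
    appendLinear P Q v = Fin.append (P v) (Q v) := rfl

@[simp] theorem fstLinear_append (u : Fin a → ℝ) (v : Fin b → ℝ) :
    fstLinear a b (Fin.append u v) = u := by
  ext t; simp [fstLinear, LinearMap.funLeft_apply]

@[simp] theorem sndLinear_append (u : Fin a → ℝ) (v : Fin b → ℝ) :
    sndLinear a b (Fin.append u v) = v := by
  ext t; simp [sndLinear, LinearMap.funLeft_apply]

@[simp] theorem reluVec_append (u : Fin a → ℝ) (v : Fin b → ℝ) :
    reluVec (Fin.append u v) = Fin.append (reluVec u) (reluVec v) := by
  ext t; refine Fin.addCases ?_ ?_ t <;> simp [reluVec]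

theorem append_add_append (u u' : Fin a → ℝ) (v v' : Fin b → ℝ) :
    Fin.append u v + Fin.append u' v' = Fin.append (u + u') (v + v') := by
  ext t; refine Fin.addCases ?_ ?_ t <;> simp

theorem sum_append {ι : Type*} (s : Finset ι) (u : ι → Fin a → ℝ) (v : ι → Fin b → ℝ) :
    ∑ j ∈ s, Fin.append (u j) (v j) = Fin.append (∑ j ∈ s, u j) (∑ j ∈ s, v j) := by
  ext t; refine Fin.addCases ?_ ?_ t <;> simp [Finset.sum_apply]

theorem relu_sub_relu_neg (x : ℝ) : relu x - relu (-x) = x := by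
  unfold relu
  rcases le_total x 0 with h | h
  · rw [max_eq_right h, max_eq_left (by linarith)]; ring
  · rw [max_eq_left h, max_eq_right (by linarith)]; ring

theorem relu_add_relu_neg (x : ℝ) : relu x + relu (-x) = |x| := by
  unfold relu
  rcases le_total x 0 with h | h
  · rw [max_eq_right h, max_eq_left (by linarith), abs_of_nonpos h]; ring
  · rw [max_eq_left h, max_eq_right (by linarith), abs_of_nonneg h]; ring

@[simp] theorem reluVec_sub_reluVec_neg (x : Fin a → ℝ) : reluVec x - reluVec (-x) = x := by
  ext t; exact relu_sub_relu_neg (x t)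

theorem continuous_relu : Continuous relu := continuous_id.max continuous_const

theorem continuous_reluVec : Continuous (reluVec : (Fin a → ℝ) → _) :=
  continuous_pi fun t => continuous_relu.comp (continuous_apply t)

end

/-! ### Closure properties of MLPs -/

namespace IsMLP

variable {a b b' : ℕ} {f : (Fin a → ℝ) → (Fin b → ℝ)} {g : (Fin a → ℝ) → (Fin b' → ℝ)}

theorem linear_relu (hf : IsMLP f) (P : (Fin b → ℝ) →ₗ[ℝ] (Fin b' → ℝ)) (c : Fin b' → ℝ) :
    IsMLP (fun x => P (reluVec (f x)) + c) := by
  have h := hf.layer (LinearMap.toMatrix' P) c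
  simp only [LinearMap.toMatrix'_mulVec] at h
  exact h

theorem of_linear (P : (Fin a → ℝ) →ₗ[ℝ] (Fin b → ℝ)) (c : Fin b → ℝ) :
    IsMLP (fun x => P x + c) := by
  have h := IsMLP.affine (LinearMap.toMatrix' P) c
  simp only [LinearMap.toMatrix'_mulVec] at h
  exact h

theorem postcomp (hf : IsMLP f) (P : (Fin b → ℝ) →ₗ[ℝ] (Fin b' → ℝ)) (c : Fin b' → ℝ) :
    IsMLP (fun x => P (f x) + c) := by
  cases hf with
  | affine W c' =>
    convert of_linear (P ∘ₗ W.mulVecLin) (P c' + c) using 2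
    simp [add_assoc]
  | layer hf W c' =>
    convert hf.linear_relu (P ∘ₗ W.mulVecLin) (P c' + c) using 2
    simp only [LinearMap.comp_apply, Matrix.mulVecLin_apply, map_add, add_assoc]
    rfl

theorem precomp (hf : IsMLP f) {a' : ℕ} (P : (Fin a' → ℝ) →ₗ[ℝ] (Fin a → ℝ)) :
    IsMLP (fun x => f (P x)) := by
  induction hf with
  | affine W c => exact of_linear (W.mulVecLin ∘ₗ P) c
  | layer hf W c ih => exact ih.layer W c

theorem append_neg (hg : IsMLP g) : IsMLP (fun x => Fin.append (g x) (-g x)) := by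
  convert hg.postcomp (appendLinear .id (-.id)) 0 using 2
  simp

/-- The pair `g, -g` passes through the ReLU and is recombined to `g` by the next linear map, while
`f` gains a layer. -/
theorem append_layer {c' : ℕ} (h : IsMLP (fun x => Fin.append (f x) (Fin.append (g x) (-g x))))
    (W : Matrix (Fin c') (Fin b) ℝ) (c : Fin c' → ℝ) :
    IsMLP (fun x => Fin.append (W.mulVec (reluVec (f x)) + c) (g x)) := by
  convert h.linear_relu (appendLinear (W.mulVecLin ∘ₗ fstLinear _ _)
    ((fstLinear _ _ - sndLinear _ _) ∘ₗ sndLinear _ _)) (Fin.append c 0) using 2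
  simp [append_add_append]

theorem append_of_linear (hf : IsMLP f) (P : (Fin a → ℝ) →ₗ[ℝ] (Fin b' → ℝ)) (c : Fin b' → ℝ) :
    IsMLP (fun x => Fin.append (f x) (P x + c)) := by
  induction hf generalizing b' with
  | affine W c' =>
    convert of_linear (appendLinear W.mulVecLin P) (Fin.append c' c) using 2
    simp [append_add_append]
  | layer hf W c' ih =>
    refine append_layer ?_ W c'
    convert ih (appendLinear P (-P)) (Fin.append c (-c)) using 3
    simp only [appendLinear_apply, append_add_append, LinearMap.neg_apply, neg_add]

/-- Layers of `f` are peeled off while `g` becomes `g, -g`, so `b'` must vary in the induction. Once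
`f` is affine, the roles swap and `append_of_linear` carries it along the layers of `g`. -/
theorem append (hf : IsMLP f) (hg : IsMLP g) : IsMLP (fun x => Fin.append (f x) (g x)) := by
  induction hf generalizing b' with
  | affine W c =>
    convert (hg.append_of_linear W.mulVecLin c).postcomp
      (appendLinear (sndLinear _ _) (fstLinear _ _)) 0 using 2
    simp
  | layer hf W c ih => exact append_layer (ih hg.append_neg) W c

theorem continuous (hf : IsMLP f) : Continuous f := by
  induction hf with
  | affine W c =>
    exact (Continuous.matrix_mulVec continuous_const continuous_id).add continuous_const
  | layer hf W c ih =>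
    exact (Continuous.matrix_mulVec continuous_const (continuous_reluVec.comp ih)).add
      continuous_const

end IsMLP

/-! ### Closure properties, continuity and equivariance of DeepSets -/

namespace IsDeepSets

variable {n a b b' : ℕ} {f : SetData n a → SetData n b} {g : SetData n a → SetData n b'}

theorem linear_relu (hf : IsDeepSets f) (P Q : (Fin b → ℝ) →ₗ[ℝ] (Fin b' → ℝ))
    (c : Fin b' → ℝ) :
    IsDeepSets (fun X i => P (reluVec (f X i)) + Q (∑ j, reluVec (f X j)) + c) := by
  have h := hf.layer (LinearMap.toMatrix' P).transpose (LinearMap.toMatrix' Q).transpose c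
  refine (congrArg IsDeepSets (funext fun X => funext fun i => ?_)).mp h
  simp only [deepSetsLayer, Matrix.vecMul_transpose, LinearMap.toMatrix'_mulVec]
  rfl

theorem of_linear (P Q : (Fin a → ℝ) →ₗ[ℝ] (Fin b → ℝ)) (c : Fin b → ℝ) :
    IsDeepSets (fun (X : SetData n a) i => P (X i) + Q (∑ j, X j) + c) := by
  have h := IsDeepSets.affine (n := n) (LinearMap.toMatrix' P).transpose
    (LinearMap.toMatrix' Q).transpose c
  refine (congrArg IsDeepSets (funext fun X => funext fun i => ?_)).mp h
  simp only [deepSetsLayer, Matrix.vecMul_transpose, LinearMap.toMatrix'_mulVec]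

theorem postcomp (hf : IsDeepSets f) (P : (Fin b → ℝ) →ₗ[ℝ] (Fin b' → ℝ)) (c : Fin b' → ℝ) :
    IsDeepSets (fun X i => P (f X i) + c) := by
  cases hf with
  | affine A B c' =>
    convert of_linear (P ∘ₗ A.vecMulLinear) (P ∘ₗ B.vecMulLinear) (P c' + c) using 3
    simp [add_assoc, deepSetsLayer, -map_sum]
  | layer hf A B c' =>
    convert hf.linear_relu (P ∘ₗ A.vecMulLinear) (P ∘ₗ B.vecMulLinear) (P c' + c) using 3
    simp only [deepSetsLayer, LinearMap.comp_apply, Matrix.vecMulLinear_apply, map_add, add_assoc]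
    rfl

theorem append_neg (hg : IsDeepSets g) :
    IsDeepSets (fun X i => Fin.append (g X i) (-g X i)) := by
  convert hg.postcomp (appendLinear .id (-.id)) 0 using 3
  simp

/-- As for MLPs; the pooled term has zero component on the carried `g`. -/
theorem append_layer {c' : ℕ}
    (h : IsDeepSets (fun X i => Fin.append (f X i) (Fin.append (g X i) (-g X i))))
    (A B : Matrix (Fin b) (Fin c') ℝ) (c : Fin c' → ℝ) :
    IsDeepSets (fun X i =>
      Fin.append (deepSetsLayer n A B c (fun l => reluVec (f X l)) i) (g X i)) := by
  convert h.linear_relu (appendLinear (A.vecMulLinear ∘ₗ fstLinear _ _)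
    ((fstLinear _ _ - sndLinear _ _) ∘ₗ sndLinear _ _))
    (appendLinear (B.vecMulLinear ∘ₗ fstLinear _ _) 0) (Fin.append c 0) using 3
  simp [append_add_append, sum_append, deepSetsLayer, -map_sum]

theorem append_of_linear (hf : IsDeepSets f) (P Q : (Fin a → ℝ) →ₗ[ℝ] (Fin b' → ℝ))
    (c : Fin b' → ℝ) :
    IsDeepSets (fun X i => Fin.append (f X i) (P (X i) + Q (∑ j, X j) + c)) := by
  induction hf generalizing b' with
  | affine A B c' =>
    convert of_linear (appendLinear A.vecMulLinear P) (appendLinear B.vecMulLinear Q)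
      (Fin.append c' c) using 3
    simp [append_add_append, deepSetsLayer, -map_sum]
  | layer hf A B c' ih =>
    refine append_layer ?_ A B c'
    convert ih (appendLinear P (-P)) (appendLinear Q (-Q)) (Fin.append c (-c)) using 4
    simp only [appendLinear_apply, append_add_append, LinearMap.neg_apply, neg_add]

theorem append (hf : IsDeepSets f) (hg : IsDeepSets g) :
    IsDeepSets (fun X i => Fin.append (f X i) (g X i)) := by
  induction hf generalizing b' with
  | affine A B c =>
    convert (hg.append_of_linear A.vecMulLinear B.vecMulLinear c).postcomp
      (appendLinear (sndLinear _ _) (fstLinear _ _)) 0 using 3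
    simp [deepSetsLayer, -map_sum]
  | layer hf A B c ih => exact append_layer (ih hg.append_neg) A B c

theorem continuous_deepSetsLayer (A B : Matrix (Fin a) (Fin b) ℝ) (c : Fin b → ℝ) :
    Continuous (deepSetsLayer n A B c) := by
  have hs : Continuous fun X : SetData n a => ∑ j, X j :=
    continuous_finsetSum _ fun j _ => continuous_apply j
  have hA : Continuous fun v : Fin a → ℝ => Matrix.vecMul v A :=
    Continuous.matrix_vecMul continuous_id continuous_const
  have hB : Continuous fun v : Fin a → ℝ => Matrix.vecMul v B :=
    Continuous.matrix_vecMul continuous_id continuous_const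
  exact continuous_pi fun i =>
    ((hA.comp (continuous_apply i)).add (hB.comp hs)).add continuous_const

theorem continuous (hf : IsDeepSets f) : Continuous f := by
  induction hf with
  | affine A B c => exact continuous_deepSetsLayer A B c
  | layer hf A B c ih =>
    exact (continuous_deepSetsLayer A B c).comp
      (continuous_pi fun i => continuous_reluVec.comp ((continuous_apply i).comp ih))

theorem setEquivariant_deepSetsLayer (A B : Matrix (Fin a) (Fin b) ℝ) (c : Fin b → ℝ) :
    SetEquivariant (deepSetsLayer n A B c) := by
  intro σ X
  funext i
  simp only [deepSetsLayer, permSet]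
  rw [Equiv.sum_comp σ⁻¹ X]

theorem setEquivariant (hf : IsDeepSets f) : SetEquivariant f := by
  induction hf with
  | affine A B c => exact setEquivariant_deepSetsLayer A B c
  | @layer _ _ f _ A B c ih =>
    intro σ X
    simp only [ih σ X]
    exact setEquivariant_deepSetsLayer A B c σ fun i => reluVec (f X i)

end IsDeepSets

/-! ### Lattice approximation -/

/-- Lattice Stone–Weierstrass for a single target: a set of continuous functions on a compact space
that is closed under maxima and minima and interpolates `f` at any two points approximates `f`. -/
theorem exists_approx_of_lattice {T : Type*} [TopologicalSpace T] [CompactSpace T]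
    (L : Set (T → ℝ)) (hne : L.Nonempty) (hL : ∀ g ∈ L, Continuous g)
    (hsup : ∀ g ∈ L, ∀ h ∈ L, (fun x => max (g x) (h x)) ∈ L)
    (hinf : ∀ g ∈ L, ∀ h ∈ L, (fun x => min (g x) (h x)) ∈ L)
    (f : T → ℝ) (hf : Continuous f) (hsep : ∀ x y, ∃ g ∈ L, g x = f x ∧ g y = f y)
    {ε : ℝ} (hε : 0 < ε) : ∃ g ∈ L, ∀ x, |f x - g x| < ε := by
  -- For fixed `x`, finitely many interpolants at `x, y` have a minimum below `f + ε` everywhere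
  -- that is still exact at `x`.
  have hupper : ∀ x, ∃ g ∈ L, g x = f x ∧ ∀ y ∈ Set.univ, g y < f y + ε := by
    intro x
    refine isCompact_univ.induction_on
      (p := fun s => ∃ g ∈ L, g x = f x ∧ ∀ y ∈ s, g y < f y + ε) ?_ ?_ ?_ ?_
    · obtain ⟨g, hg, h, -⟩ := hsep x x
      exact ⟨g, hg, h, by simp⟩
    · rintro s t hst ⟨g, hg, h, h'⟩
      exact ⟨g, hg, h, fun y hy => h' y (hst hy)⟩
    · rintro s t ⟨g, hg, hgx, hgs⟩ ⟨h, hh, hhx, hht⟩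
      refine ⟨_, hinf g hg h hh, by simp [hgx, hhx], ?_⟩
      rintro y (hy | hy)
      · exact min_lt_of_left_lt (hgs y hy)
      · exact min_lt_of_right_lt (hht y hy)
    · intro y _
      obtain ⟨g, hg, hgx, hgy⟩ := hsep x y
      refine ⟨{z | g z < f z + ε}, mem_nhdsWithin_of_mem_nhds ?_, g, hg, hgx, fun z hz => hz⟩
      exact (isOpen_lt (hL g hg) (hf.add continuous_const)).mem_nhds (by simp [hgy, hε])
  -- A finite maximum of such functions, over varying `x`, is also above `f - ε`.
  have hlower : ∃ g ∈ L, (∀ y, g y < f y + ε) ∧ ∀ y ∈ Set.univ, f y - ε < g y := by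
    refine isCompact_univ.induction_on
      (p := fun s => ∃ g ∈ L, (∀ y, g y < f y + ε) ∧ ∀ y ∈ s, f y - ε < g y) ?_ ?_ ?_ ?_
    · rcases isEmpty_or_nonempty T with _ | ⟨⟨x⟩⟩
      · obtain ⟨g, hg⟩ := hne
        exact ⟨g, hg, fun y => isEmptyElim y, by simp⟩
      · obtain ⟨g, hg, -, h⟩ := hupper x
        exact ⟨g, hg, fun y => h y trivial, by simp⟩
    · rintro s t hst ⟨g, hg, h, h'⟩
      exact ⟨g, hg, h, fun y hy => h' y (hst hy)⟩
    · rintro s t ⟨g, hg, hgu, hgs⟩ ⟨h, hh, hhu, hht⟩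
      refine ⟨_, hsup g hg h hh, fun y => max_lt (hgu y) (hhu y), ?_⟩
      rintro y (hy | hy)
      · exact lt_max_of_lt_left (hgs y hy)
      · exact lt_max_of_lt_right (hht y hy)
    · intro x _
      obtain ⟨g, hg, hgx, hgu⟩ := hupper x
      refine ⟨{z | f z - ε < g z}, mem_nhdsWithin_of_mem_nhds ?_, g, hg,
        fun y => hgu y trivial, fun z hz => hz⟩
      exact (isOpen_lt (hf.sub continuous_const) (hL g hg)).mem_nhds (by simp [hgx, hε])
  obtain ⟨g, hg, hu, hl⟩ := hlower
  exact ⟨g, hg, fun x => abs_lt.2 ⟨by linarith [hu x], by linarith [hl x trivial]⟩⟩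

/-! ### Closure properties of the edge model -/

section edgeModel

variable {n din k b b' : ℕ}

theorem continuous_broadcast {d₁ : ℕ} (i : Fin k → Fin n) :
    Continuous fun X : SetData n d₁ => broadcast k X i :=
  continuous_pi fun _ => (continuous_apply _).comp (continuous_apply _)

theorem edgeEquivariant_of_mem_edgeModel {Φ : SetModel n din}
    (hΦ : ∀ d₁ : ℕ, ∀ φ ∈ Φ d₁, SetEquivariant φ) {F : SetData n din → EdgeData n k b}
    (hF : F ∈ edgeModel Φ k b) : EdgeEquivariant F := by
  obtain ⟨d₁, φ, m, hφ, -, rfl⟩ := hF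
  intro σ X
  simp only [hΦ d₁ φ hφ σ X]
  rfl

variable {F : SetData n din → EdgeData n k b} {F' : SetData n din → EdgeData n k b'}

theorem continuous_of_mem_edgeModel (hF : F ∈ edgeModel (deepSets n din) k b) :
    Continuous F := by
  obtain ⟨d₁, φ, m, hφ, hm, rfl⟩ := hF
  exact continuous_pi fun i =>
    hm.continuous.comp ((continuous_broadcast i).comp (IsDeepSets.continuous hφ))

theorem edgeModel_postcomp {Φ : SetModel n din} (hF : F ∈ edgeModel Φ k b)
    (P : (Fin b → ℝ) →ₗ[ℝ] (Fin b' → ℝ)) (c : Fin b' → ℝ) :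
    (fun X i => P (F X i) + c) ∈ edgeModel Φ k b' := by
  obtain ⟨d₁, φ, m, hφ, hm, rfl⟩ := hF
  exact ⟨d₁, φ, _, hφ, hm.postcomp P c, rfl⟩

theorem edgeModel_reluVec {Φ : SetModel n din} (hF : F ∈ edgeModel Φ k b) :
    (fun X i => reluVec (F X i)) ∈ edgeModel Φ k b := by
  obtain ⟨d₁, φ, m, hφ, hm, rfl⟩ := hF
  refine ⟨d₁, φ, _, hφ, hm.linear_relu .id 0, ?_⟩
  funext X i
  simp [edgewise]

theorem edgeModel_append (hF : F ∈ edgeModel (deepSets n din) k b)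
    (hF' : F' ∈ edgeModel (deepSets n din) k b') :
    (fun X i => Fin.append (F X i) (F' X i)) ∈ edgeModel (deepSets n din) k (b + b') := by
  obtain ⟨d₁, φ, m, hφ, hm, rfl⟩ := hF
  obtain ⟨d₂, φ', m', hφ', hm', rfl⟩ := hF'
  -- Broadcasting `[φ, φ']` interleaves the two feature blocks, so each MLP first selects its own
  -- coordinates from every block.
  refine ⟨d₁ + d₂, _, _, IsDeepSets.append hφ hφ',
    (hm.precomp (LinearMap.funLeft ℝ ℝ fun s => finProdFinEquiv
      ((finProdFinEquiv.symm s).1, Fin.castAdd d₂ (finProdFinEquiv.symm s).2))).append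
    (hm'.precomp (LinearMap.funLeft ℝ ℝ fun s => finProdFinEquiv
      ((finProdFinEquiv.symm s).1, Fin.natAdd d₁ (finProdFinEquiv.symm s).2))), ?_⟩
  funext X i
  simp only [edgewise]
  congr 2 <;> ext s <;> simp [broadcast, LinearMap.funLeft_apply, -finProdFinEquiv_symm_apply]

theorem mem_edgeModel_of_isDeepSets {φ : SetData n din → SetData n b} (hφ : IsDeepSets φ)
    (t : Fin k) : (fun X i => φ X (i t)) ∈ edgeModel (deepSets n din) k b := by
  refine ⟨b, φ, _, hφ, .of_linear (LinearMap.funLeft ℝ ℝ fun s => finProdFinEquiv (t, s)) 0, ?_⟩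
  funext X i s
  simp [edgewise, broadcast, LinearMap.funLeft_apply, -finProdFinEquiv_symm_apply]

theorem edgeModel_const (c : Fin b → ℝ) :
    (fun _ _ => c) ∈ edgeModel (deepSets n din) k b := by
  refine ⟨0, _, _, .of_linear 0 0 0, .of_linear 0 c, ?_⟩
  funext X i
  simp [edgewise]

end edgeModel

/-! ### The lattice of scalar edge functions -/

/-- The real-valued functions of a set and a `k`-edge computed by the DeepSets edge model. -/
def deepSetsScalar (n din k : ℕ) : Set (SetData n din → (Fin k → Fin n) → ℝ) :=
  {f | (fun X i (_ : Fin 1) => f X i) ∈ edgeModel (deepSets n din) k 1}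

section deepSetsScalar

variable {n din k : ℕ} {f g : SetData n din → (Fin k → Fin n) → ℝ}

theorem deepSetsScalar_const (c : ℝ) : (fun _ _ => c) ∈ deepSetsScalar n din k :=
  edgeModel_const fun _ => c

theorem deepSetsScalar_affine (hf : f ∈ deepSetsScalar n din k)
    (hg : g ∈ deepSetsScalar n din k) (r s c : ℝ) :
    (fun X i => r * f X i + s * g X i + c) ∈ deepSetsScalar n din k := by
  have h := edgeModel_postcomp (edgeModel_append hf hg)
    (r • fstLinear 1 1 + s • sndLinear 1 1) (fun _ => c)
  simp only [LinearMap.add_apply, LinearMap.smul_apply, fstLinear_append, sndLinear_append] at h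
  exact h

theorem deepSetsScalar_relu (hf : f ∈ deepSetsScalar n din k) :
    (fun X i => relu (f X i)) ∈ deepSetsScalar n din k :=
  edgeModel_reluVec hf

theorem deepSetsScalar_max (hf : f ∈ deepSetsScalar n din k)
    (hg : g ∈ deepSetsScalar n din k) :
    (fun X i => max (f X i) (g X i)) ∈ deepSetsScalar n din k := by
  -- `max f g = relu (f - g) + g`.
  convert deepSetsScalar_affine (deepSetsScalar_relu (deepSetsScalar_affine hf hg 1 (-1) 0)) hg
    1 1 0 using 1
  funext X i
  simp only [relu]
  rcases le_total (f X i) (g X i) with h | h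
  · rw [max_eq_right h, max_eq_right (by linarith)]; ring
  · rw [max_eq_left h, max_eq_left (by linarith)]; ring

theorem deepSetsScalar_min (hf : f ∈ deepSetsScalar n din k)
    (hg : g ∈ deepSetsScalar n din k) :
    (fun X i => min (f X i) (g X i)) ∈ deepSetsScalar n din k := by
  convert deepSetsScalar_affine (deepSetsScalar_affine hf hg 1 1 0) (deepSetsScalar_max hf hg)
    1 (-1) 0 using 1
  funext X i
  linarith [min_add_max (f X i) (g X i)]

theorem continuous_of_mem_deepSetsScalar (hf : f ∈ deepSetsScalar n din k)
    (i : Fin k → Fin n) : Continuous fun X => f X i :=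
  (continuous_apply (0 : Fin 1)).comp
    ((continuous_apply i).comp (continuous_of_mem_edgeModel hf))

/-- Scalar outputs can be computed jointly. -/
theorem exists_mem_edgeModel_of_scalar (dout : ℕ)
    (f : Fin dout → SetData n din → (Fin k → Fin n) → ℝ)
    (hf : ∀ j, f j ∈ deepSetsScalar n din k) :
    (fun X i j => f j X i) ∈ edgeModel (deepSets n din) k dout := by
  induction dout with
  | zero =>
    convert edgeModel_const (n := n) (din := din) (k := k) (fun _ : Fin 0 => (0 : ℝ)) using 1
  | succ d ih =>
    convert edgeModel_append (ih (fun j => f j.castSucc) fun j => hf _) (hf (Fin.last d)) using 1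
    funext X i j
    refine Fin.addCases (m := d) (n := 1) (fun j => ?_) (fun j => ?_) j
    · exact (Fin.append_left (fun j : Fin d => f j.castSucc X i)
        (fun _ : Fin 1 => f (Fin.last d) X i) j).symm
    · rw [Fin.append_right, Subsingleton.elim j 0]
      rfl

end deepSetsScalar

/-! ### Separation of orbits -/

/-- Two sets with the same rows, counted with multiplicity, that agree along two `k`-edges differ by
a permutation that takes one `k`-edge to the other. -/
theorem exists_perm_of_card_eq {n k : ℕ} {α : Type*} [DecidableEq α] {X Y : Fin n → α}
    {i j : Fin k → Fin n} (hi : Function.Injective i) (hj : Function.Injective j)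
    (hij : ∀ t, X (i t) = Y (j t))
    (hcard : ∀ p, Fintype.card {l // X l = p} = Fintype.card {l // Y l = p}) :
    ∃ σ : Equiv.Perm (Fin n), (∀ l, Y (σ l) = X l) ∧ ∀ t, σ (i t) = j t := by
  classical
  -- `τ` is already right on the edge. Off the edge, equal counts of each row value remain, so it is
  -- corrected there by a fiberwise bijection `e`.
  obtain ⟨τ, hτ⟩ := Equiv.Perm.exists_extending_pair i j hi hj
  let S : Set (Fin n) := Set.range i
  have hS : ∀ l ∈ S, Y (τ l) = X l := by
    rintro _ ⟨t, rfl⟩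
    rw [hτ, hij]
  have hsplit : ∀ (Z : Fin n → α) (p : α), Fintype.card {l // Z l = p} =
      Fintype.card {l // l ∈ S ∧ Z l = p} + Fintype.card {l : {l // l ∉ S} // Z l = p} := by
    intro Z p
    rw [Fintype.card_congr (Equiv.subtypeSubtypeEquivSubtypeInter (· ∉ S) (Z · = p))]
    simp only [Fintype.card_subtype]
    rw [← Finset.card_filter_add_card_filter_not (s := Finset.univ.filter (Z · = p)) (· ∈ S)]
    simp only [Finset.filter_filter, and_comm]
  have hcompl : ∀ p, Fintype.card {l : {l // l ∉ S} // X l = p} =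
      Fintype.card {l : {l // l ∉ S} // Y (τ l) = p} := by
    intro p
    have h1 : Fintype.card {l // Y (τ l) = p} = Fintype.card {l // Y l = p} :=
      Fintype.card_congr (τ.subtypeEquiv fun _ => Iff.rfl)
    have h2 : Fintype.card {l // l ∈ S ∧ X l = p} = Fintype.card {l // l ∈ S ∧ Y (τ l) = p} :=
      Fintype.card_congr (Equiv.subtypeEquivRight fun l =>
        and_congr_right fun hl => by rw [hS l hl])
    have h3 := hsplit X p
    have h4 := hsplit (fun l => Y (τ l)) p
    have h5 := hcard p
    omega
  let e : {l // l ∉ S} ≃ {l // l ∉ S} :=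
    Equiv.ofFiberEquiv (f := fun l => X l) (g := fun l => Y (τ l))
      fun p => Fintype.equivOfCardEq (hcompl p)
  have he : ∀ l, Y (τ (e l)) = X l :=
    Equiv.ofFiberEquiv_map (f := fun l : {l // l ∉ S} => X l)
      (g := fun l : {l // l ∉ S} => Y (τ l)) _
  refine ⟨(Equiv.Perm.ofSubtype e).trans τ, fun l => ?_, fun t => ?_⟩
  · by_cases hl : l ∈ S
    · simp [Equiv.Perm.ofSubtype_apply_of_not_mem e (not_not.2 hl), hS l hl]
    · have := he ⟨l, hl⟩
      simpa [Equiv.Perm.ofSubtype_apply_of_mem e hl] using this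
  · have : i t ∈ S := ⟨t, rfl⟩
    simp [Equiv.Perm.ofSubtype_apply_of_not_mem e (not_not.2 this), hτ]

section

variable {n k din dout : ℕ}

/-- A ReLU bump at `p`. -/
def bump {d : ℕ} (c : ℝ) (p x : Fin d → ℝ) : ℝ := relu (1 + -c * ∑ t, |x t - p t|)

theorem bump_self {d : ℕ} (c : ℝ) (p : Fin d → ℝ) : bump c p p = 1 := by
  simp [bump, relu]

theorem bump_eq_zero {d : ℕ} {c : ℝ} {p x : Fin d → ℝ} (hx : x ≠ p)
    (hc : (∑ t, |x t - p t|)⁻¹ ≤ c) : bump c p x = 0 := by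
  have hpos : 0 < ∑ t, |x t - p t| := by
    obtain ⟨t, ht⟩ := Function.ne_iff.1 hx
    exact Finset.sum_pos' (fun _ _ => abs_nonneg _)
      ⟨t, Finset.mem_univ t, abs_pos.2 (sub_ne_zero.2 ht)⟩
  have h := mul_le_mul_of_nonneg_right hc hpos.le
  rw [inv_mul_cancel₀ hpos.ne'] at h
  exact max_eq_right (by linarith)

/-- For large `c` the bump vanishes at every row other than `p`. At a row equal to `p`, `hc` only
says `0 ≤ c`, since `0⁻¹ = 0`. -/
theorem sum_bump_eq_card (X : SetData n din) (p : Fin din → ℝ) (c : ℝ)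
    (hc : ∀ l, (∑ t, |X l t - p t|)⁻¹ ≤ c) :
    ∑ l, bump c p (X l) = Fintype.card {l // X l = p} := by
  classical
  have h : ∀ l, bump c p (X l) = if X l = p then 1 else 0 := by
    intro l
    split_ifs with hl
    · rw [hl, bump_self]
    · exact bump_eq_zero hl (hc l)
  simp [h, Fintype.card_subtype]

/-- Two ReLU layers suffice: the first yields `|x - p|` as `relu v + relu (-v)`, the second the
bump, which the last layer pools. -/
theorem isDeepSets_sum_bump (c : ℝ) (p : Fin din → ℝ) :
    IsDeepSets (fun (X : SetData n din) _ (_ : Fin 1) => ∑ l, bump c p (X l)) := by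
  have h := ((IsDeepSets.of_linear (n := n) .id 0 (-p)).append_neg.linear_relu
    ((LinearMap.pi fun _ : Fin 1 => -c • ∑ t, LinearMap.proj t) ∘ₗ
      (fstLinear din din + sndLinear din din)) 0 (fun _ => 1)).linear_relu 0 .id 0
  refine (congrArg IsDeepSets (funext fun X => funext fun i => funext fun t => ?_)).mp h
  simp only [LinearMap.zero_apply, zero_add, add_zero, Finset.sum_apply, LinearMap.id_apply]
  refine Finset.sum_congr rfl fun l _ => congrArg relu ?_
  have hsum : ∀ v : Fin din → ℝ, ∑ s, (reluVec v s + reluVec (-v) s) = ∑ s, |v s| :=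
    fun v => Finset.sum_congr rfl fun s _ => relu_add_relu_neg (v s)
  simp only [LinearMap.comp_apply, LinearMap.pi_apply, LinearMap.smul_apply, LinearMap.sum_apply,
    LinearMap.proj_apply, LinearMap.add_apply, reluVec_append, fstLinear_append,
    sndLinear_append, Pi.add_apply, hsum, smul_eq_mul, Pi.neg_apply]
  rw [add_comm]
  rfl

theorem exists_deepSetsScalar_ne (hk : 1 ≤ k) {G : SetData n din → EdgeData n k dout}
    (hG : EdgeEquivariant G) {X Y : SetData n din} {i j : Fin k → Fin n}
    (hi : Function.Injective i) (hj : Function.Injective j) (hne : G X i ≠ G Y j) :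
    ∃ f ∈ deepSetsScalar n din k, f X i ≠ f Y j := by
  classical
  by_contra! hcon
  have hrow : ∀ t, X (i t) = Y (j t) := by
    intro t
    funext s
    refine hcon (fun X i => X (i t) s) ?_
    have h := mem_edgeModel_of_isDeepSets (IsDeepSets.of_linear (n := n)
      (LinearMap.funLeft ℝ ℝ fun _ : Fin 1 => s) 0 0) t
    simp only [LinearMap.zero_apply, add_zero] at h
    exact h
  have hcard : ∀ p, Fintype.card {l // X l = p} = Fintype.card {l // Y l = p} := by
    intro p
    -- A sum of nonnegative terms, hence at least each inverse distance for both sets.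
    let c : ℝ := ∑ l, (∑ t, |X l t - p t|)⁻¹ + ∑ l, (∑ t, |Y l t - p t|)⁻¹
    have hnn : ∀ (Z : SetData n din) l, 0 ≤ (∑ t, |Z l t - p t|)⁻¹ := fun Z l =>
      inv_nonneg.2 (Finset.sum_nonneg fun _ _ => abs_nonneg _)
    have hle : ∀ (Z : SetData n din) l,
        (∑ t, |Z l t - p t|)⁻¹ ≤ ∑ l, (∑ t, |Z l t - p t|)⁻¹ := fun Z l =>
      Finset.single_le_sum (f := fun l => (∑ t, |Z l t - p t|)⁻¹) (fun l _ => hnn Z l)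
        (Finset.mem_univ l)
    -- The pooled count is the same in every row; `1 ≤ k` supplies a position at which to read it.
    have h := hcon (fun X _ => ∑ l, bump c p (X l))
      (mem_edgeModel_of_isDeepSets (isDeepSets_sum_bump c p) ⟨0, hk⟩)
    beta_reduce at h
    rw [sum_bump_eq_card X p c fun l => (hle X l).trans
        (le_add_of_nonneg_right (Finset.sum_nonneg fun l _ => hnn Y l)),
      sum_bump_eq_card Y p c fun l => (hle Y l).trans
        (le_add_of_nonneg_left (Finset.sum_nonneg fun l _ => hnn X l))] at h
    exact_mod_cast h
  obtain ⟨σ, hσ, hσi⟩ := exists_perm_of_card_eq hi hj hrow hcard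
  have hY : permSet σ X = Y := by
    funext l
    rw [permSet, ← hσ]
    exact congrArg Y (σ.apply_symm_apply l)
  refine hne ?_
  rw [← hY, hG σ X, permEdge]
  congr 1
  funext t
  rw [← hσi]
  exact (σ.symm_apply_apply (i t)).symm

/-! ### Universality -/

theorem isEdgeUniversal_deepSets (hk : 1 ≤ k) :
    IsEdgeUniversal (edgeModel (deepSets n din) k dout) := by
  refine ⟨fun F => edgeEquivariant_of_mem_edgeModel
    fun _ φ hφ => IsDeepSets.setEquivariant hφ, fun G hGc hG K hK ε hε => ?_⟩
  have : CompactSpace K := isCompact_iff_compactSpace.1 hK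
  let ev : (SetData n din → (Fin k → Fin n) → ℝ) →
      K × {i : Fin k → Fin n // Function.Injective i} → ℝ := fun f x => f x.1 x.2
  have hcont : ∀ f : SetData n din → (Fin k → Fin n) → ℝ,
      (∀ i, Continuous fun X => f X i) → Continuous (ev f) := by
    intro f hf
    exact continuous_prod_of_discrete_right.2 fun i => (hf i).comp continuous_subtype_val
  have happrox : ∀ j : Fin dout, ∃ f ∈ deepSetsScalar n din k,
      ∀ x, |ev (fun X i => G X i j) x - ev f x| < ε := by
    intro j
    suffices h : ∃ g ∈ ev '' deepSetsScalar n din k, ∀ x, |ev (fun X i => G X i j) x - g x| < ε by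
      obtain ⟨_, ⟨f, hf, rfl⟩, h⟩ := h
      exact ⟨f, hf, h⟩
    refine exists_approx_of_lattice _ (.image _ ⟨_, deepSetsScalar_const 0⟩) ?_ ?_ ?_ _ ?_ ?_ hε
    · rintro _ ⟨f, hf, rfl⟩
      exact hcont f (continuous_of_mem_deepSetsScalar hf)
    · rintro _ ⟨f, hf, rfl⟩ _ ⟨g, hg, rfl⟩
      exact ⟨_, deepSetsScalar_max hf hg, rfl⟩
    · rintro _ ⟨f, hf, rfl⟩ _ ⟨g, hg, rfl⟩
      exact ⟨_, deepSetsScalar_min hf hg, rfl⟩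
    · exact hcont _ fun i => (continuous_apply j).comp ((continuous_apply i).comp hGc)
    · rintro ⟨X, i⟩ ⟨Y, l⟩
      by_cases hXY : G X i j = G Y l j
      · exact ⟨_, ⟨_, deepSetsScalar_const (G X i j), rfl⟩, rfl, hXY⟩
      · obtain ⟨f, hf, hne⟩ := exists_deepSetsScalar_ne hk hG i.2 l.2
          fun h => hXY (congrFun h j)
        have hd := sub_ne_zero.2 hne
        let r : ℝ := (G X i j - G Y l j) / (f X i - f Y l)
        have hr : r * (f X i - f Y l) = G X i j - G Y l j := div_mul_cancel₀ _ hd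
        -- The affine function of `f` with slope `r` takes both prescribed values.
        refine ⟨_, ⟨_, deepSetsScalar_affine hf hf r 0 (G X i j - r * f X i), rfl⟩, ?_, ?_⟩
        · simp only [ev]
          ring
        · simp only [ev]
          linarith
  choose f hf hfε using happrox
  exact ⟨_, exists_mem_edgeModel_of_scalar dout f hf,
    fun X hX i hi j => hfε j (⟨X, hX⟩, ⟨i, hi⟩)⟩

/-- Universality of the edge model passes from DeepSets to any universal set-to-set model. -/
theorem isEdgeUniversal_of_isUniversal (hk : 1 ≤ k) {Φ : SetModel n din} (hΦ : Φ.IsUniversal) :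
    IsEdgeUniversal (edgeModel Φ k dout) := by
  refine ⟨fun F => edgeEquivariant_of_mem_edgeModel hΦ.1, fun G hGc hG K hK ε hε => ?_⟩
  obtain ⟨_, ⟨d₁, φ, m, hφ, hm, rfl⟩, hF⟩ :=
    (isEdgeUniversal_deepSets hk).2 G hGc hG K hK (ε / 2) (half_pos hε)
  have hφc : Continuous φ := IsDeepSets.continuous hφ
  let C : Set (Fin (k * d₁) → ℝ) := ⋃ i : Fin k → Fin n, (fun X => broadcast k (φ X) i) '' K
  have hC : IsCompact C := isCompact_iUnion fun i =>
    hK.image ((continuous_broadcast i).comp hφc)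
  -- Only one of the two points has to lie in `C`: the broadcast of `φ'` may leave it.
  obtain ⟨δ, hδ, hmδ⟩ := Metric.mem_uniformity_dist.1
    (hC.uniformContinuousAt_of_continuousAt m (fun _ _ => hm.continuous.continuousAt)
      (Metric.dist_mem_uniformity (half_pos hε)))
  obtain ⟨φ', hφ', hδ'⟩ := hΦ.2 d₁ φ hφc (IsDeepSets.setEquivariant hφ) K hK δ hδ
  refine ⟨_, ⟨d₁, φ', m, hφ', hm, rfl⟩, fun X hX i hi j => ?_⟩
  have hdist : dist (broadcast k (φ X) i) (broadcast k (φ' X) i) < δ :=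
    (dist_pi_lt_iff hδ).2 fun s => hδ' X hX _ _
  have h1 : dist (m (broadcast k (φ X) i)) (m (broadcast k (φ' X) i)) < ε / 2 :=
    hmδ hdist (Set.mem_iUnion.2 ⟨i, X, hX, rfl⟩)
  have h2 : |m (broadcast k (φ X) i) j - m (broadcast k (φ' X) i) j| < ε / 2 :=
    (dist_pi_lt_iff (half_pos hε)).1 h1 j
  have h3 := hF X hX i hi j
  exact (abs_sub_le _ _ _).trans_lt (by simp only [edgewise] at h3 ⊢; linarith)

end

end SetToGraph

theorem theorem1 (n k din dout : ℕ) (hk : 1 ≤ k) :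
    (∀ Φ : SetToGraph.SetModel n din, Φ.IsUniversal →
      SetToGraph.IsEdgeUniversal (SetToGraph.edgeModel Φ k dout)) ∧
    SetToGraph.IsEdgeUniversal
      (SetToGraph.edgeModel (SetToGraph.deepSets n din) k dout) :=
  ⟨fun _ hΦ => SetToGraph.isEdgeUniversal_of_isUniversal hk hΦ,
    SetToGraph.isEdgeUniversal_deepSets hk⟩
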